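/- Let $\lambda,\alpha$ be real numbers with $|\lambda|<\pi/2$ and $0\le\alpha<1$, and let $a,b\in\mathbb{C}$ with $a+b\ne-1,-2,-3,\dots$. Put $$L=\Re\big[e^{-i\lambda}ab\,(2-\alpha+(1-\alpha)e^{-2i\lambda})\big],$$ $$M=\Im\big[e^{-i\lambda}ab\,(\bar a+\bar b-(1-\alpha)(1+e^{-2i\lambda}))\big],$$ $$N=\Re\big[e^{-i\lambda}ab\,(2\bar a+2\bar b+\alpha-(1-\alpha)e^{-2i\lambda})\big]-\frac{|a|^2|b|^2}{(1-\alpha)\cos\lambda}.$$ If $\Re[e^{-i\lambda}ab]>0$, $L\ge0$, $N\ge0$ and $LN-M^2\ge0$, then the shifted hypergeometric function $f(z)=z\,{}_2F_1(a,b;a+b+1;z)$ is $\lambda$-spirallike of order $\alpha$. That is, $f$ is analytic on the unit disk $\mathbb{D}=\{|z|<1\}$, $f(0)=0$, $f'(0)=1$, $f(z)\ne0$ for $0<|z|<1$, and $$\Re\left(e^{-i\lambda}\frac{zf'(z)}{f(z)}\right)>\alpha\cos\lambda,\qquad z\in\mathbb{D},$$ where $zf'(z)/f(z)$ takes its limiting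 value $1$ at $z=0$. -/

import Mathlib

/-- The class of analytic functions `f` on the open unit disk with `f 0 = 0` and `f' 0 = 1`. -/
def IsNormalizedAnalytic (f : ℂ → ℂ) : Prop :=
  AnalyticOnNhd ℂ f (Metric.ball 0 1) ∧ f 0 = 0 ∧ deriv f 0 = 1

/-- `f` is `l`-spirallike of order `α`: `f` is a normalized analytic function on the unit disk and
`Re (e^{-i l} z f'(z) / f(z)) > α cos l` on the disk. The quotient is required to make sense, i.e.
`f z ≠ 0` for `z ≠ 0`; at `z = 0` it has the removable value `1`, for which the inequality reads
`cos l > α cos l` and holds as soon as `|l| < π / 2` and `α < 1`. -/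
def IsSpirallikeOfOrder (l α : ℝ) (f : ℂ → ℂ) : Prop :=
  IsNormalizedAnalytic f ∧
    ∀ z : ℂ, ‖z‖ < 1 → z ≠ 0 →
      f z ≠ 0 ∧
        α * Real.cos l < (Complex.exp (-(Complex.I * (l : ℂ))) * (z * deriv f z / f z)).re

/-- The shifted hypergeometric function `z ↦ z ₂F₁(a, b; c; z)`. -/
noncomputable def shiftedHypergeometric (a b c : ℂ) (z : ℂ) : ℂ :=
  z * ordinaryHypergeometric a b c z

/-- `L = Re [e^{-i l} a b (2 - α + (1 - α) e^{-2 i l})]`. -/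
noncomputable def spiralL (l α : ℝ) (a b : ℂ) : ℝ :=
  (Complex.exp (-(Complex.I * (l : ℂ))) * a * b *
    (2 - (α : ℂ) + (1 - (α : ℂ)) * Complex.exp (-(2 * Complex.I * (l : ℂ))))).re

/-- `M = Im [e^{-i l} a b (conj a + conj b - (1 - α) (1 + e^{-2 i l}))]`. -/
noncomputable def spiralM (l α : ℝ) (a b : ℂ) : ℝ :=
  (Complex.exp (-(Complex.I * (l : ℂ))) * a * b *
    ((starRingEnd ℂ) a + (starRingEnd ℂ) b
      - (1 - (α : ℂ)) * (1 + Complex.exp (-(2 * Complex.I * (l : ℂ)))))).im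

/-- `N = Re [e^{-i l} a b (2 conj a + 2 conj b + α - (1 - α) e^{-2 i l})]
- |a|² |b|² / ((1 - α) cos l)`. -/
noncomputable def spiralN (l α : ℝ) (a b : ℂ) : ℝ :=
  (Complex.exp (-(Complex.I * (l : ℂ))) * a * b *
    (2 * (starRingEnd ℂ) a + 2 * (starRingEnd ℂ) b + (α : ℂ)
      - (1 - (α : ℂ)) * Complex.exp (-(2 * Complex.I * (l : ℂ))))).re
    - ‖a‖ ^ 2 * ‖b‖ ^ 2 / ((1 - α) * Real.cos l)

/-!
Put `F = ₂F₁(a, b; a + b + 1; ·)`, `q = z F' / F` and `κ = (1 - α) cos l · e^{i l}`. Spirallikeness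
of order `α` of `z F(z)` means that `1 + q / κ`, which equals `1` at the origin, stays in the right
half-plane. Suppose it first touches the imaginary axis at `z`. By Jack's lemma in its half-plane
form, which is the principle of Miller and Mocanu, `q(z) = κ (i s - 1)` and `z q'(z) = κ t` with
`s, t` real and `t ≤ -(1 + s²) / 2`. (Zeros of `F` do not come first: `Re (q / κ)` tends to `-∞`
along the radius leading to one.)

The hypergeometric equation is the Riccati equation `z q' + q² + (a + b) q = a b z / (1 - z)`.
After conjugation and multiplication by `a b`, its left side has real part at most
`-(L s² - 2 M s + N) / 2 - |a b|² / (2 (1 - α) cos l)` up to the factor `(1 - α) cos l`, and its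
right side `|a b|² Re (z / (1 - z))`, which exceeds `-|a b|² / 2`. The conditions on `L`, `M`, `N`
say that the quadratic form is nonnegative, a contradiction.
-/

open Metric Filter Topology ComplexConjugate

theorem sub_mem_posTangentConeAt_of_mem_interior {E : Type*} [NormedAddCommGroup E]
    [NormedSpace ℝ E] {s : Set E} {x y : E} (hs : Convex ℝ s) (hx : x ∈ closure s)
    (hy : y ∈ interior s) : y - x ∈ posTangentConeAt s x := by
  refine mem_posTangentConeAt_of_frequently_mem (Eventually.frequently ?_)
  filter_upwards [Ioc_mem_nhdsGT zero_lt_one] with t ht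
  exact interior_subset (hs.add_smul_sub_mem_interior' hx hy ht)

theorem eq_norm_of_forall_re_mul_le {u : ℂ}
    (hu : ∀ ζ : ℂ, ‖ζ‖ < 1 → (ζ * u).re ≤ u.re) : u = ‖u‖ := by
  have norm_le_re : ‖u‖ ≤ u.re := by
    rcases eq_or_ne u 0 with rfl | hu0
    · simp
    have hlim : Tendsto (fun r : ℝ => r * ‖u‖) (𝓝[<] 1) (𝓝 ‖u‖) := by
      simpa using (tendsto_id.mul_const ‖u‖).mono_left (nhdsWithin_le_nhds (a := (1 : ℝ)))
    refine le_of_tendsto hlim ?_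
    filter_upwards [Ioo_mem_nhdsLT zero_lt_one] with r hr
    have hmul : r * (conj u / ‖u‖) * u = ((r * ‖u‖ : ℝ) : ℂ) := by
      have hunorm : (‖u‖ : ℂ) ≠ 0 := by exact_mod_cast norm_ne_zero_iff.2 hu0
      push_cast
      field_simp
      rw [mul_assoc, Complex.conj_mul']
    have hζ := hu (r * (conj u / ‖u‖)) (by
      simpa [hu0, abs_of_pos hr.1] using hr.2)
    rwa [hmul, Complex.ofReal_re] at hζ
  have hre : u.re = ‖u‖ := le_antisymm (Complex.re_le_norm u) norm_le_re
  exact Complex.eq_coe_norm_of_nonneg (Complex.re_eq_norm.1 hre)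

theorem re_sub_nonneg_of_isLocalMinOn {f : ℂ → ℂ} {d v z : ℂ} {c : ℝ} {s : Set ℂ}
    (hd : HasDerivAt f d z) (hmin : IsLocalMinOn (fun w => c ^ 2 * ‖w‖ ^ 2 - ‖f w‖ ^ 2) s z)
    (hv : v ∈ posTangentConeAt s z) :
    0 ≤ ((c : ℂ) ^ 2 * (v * conj z) - v * d * conj (f z)).re := by
  have hderiv := ((hasFDerivAt_id (𝕜 := ℝ) z).norm_sq.const_mul (c ^ 2)).sub
    (hd.hasFDerivAt.restrictScalars ℝ).norm_sq
  have hnonneg := hmin.hasFDerivWithinAt_nonneg hderiv.hasFDerivWithinAt hv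
  refine nonneg_of_mul_nonneg_right (a := 2) (le_of_le_of_eq hnonneg ?_) two_pos
  simp only [← Complex.ofReal_pow, Complex.sub_re, Complex.re_ofReal_mul, sub_apply, smul_apply,
    ContinuousLinearMap.comp_id, ContinuousLinearMap.comp_apply,
    ContinuousLinearMap.coe_restrictScalars', ContinuousLinearMap.toSpanSingleton_apply,
    coe_innerSL_apply, Complex.inner, id_eq, nsmul_eq_mul, smul_eq_mul, Nat.cast_ofNat]
  ring

/-- Jack's lemma. By Schwarz, the nonnegative function `(‖f z‖ / ‖z‖ * ‖w‖) ^ 2 - ‖f w‖ ^ 2` of `w`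
attains its minimum over the disk at `z`, so its derivative is nonnegative in every inward direction
`ζ * z - z`. -/
theorem exists_mul_deriv_eq_mul_of_mapsTo_ball {f : ℂ → ℂ} {d z : ℂ} (hz : z ≠ 0)
    (hf : DifferentiableOn ℂ f (ball 0 ‖z‖)) (hf0 : f 0 = 0)
    (hmaps : Set.MapsTo f (ball 0 ‖z‖) (closedBall 0 ‖f z‖)) (hfz : f z ≠ 0)
    (hd : HasDerivAt f d z) : ∃ m : ℝ, 1 ≤ m ∧ z * d = m * f z := by
  set u : ℂ := z * d * conj (f z) - f z * conj (f z) with hu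
  set c : ℝ := ‖f z‖ / ‖z‖
  have hz' : 0 < ‖z‖ := norm_pos_iff.2 hz
  have hcz : (c : ℂ) ^ 2 * (z * conj z) = f z * conj (f z) := by
    rw [Complex.mul_conj', Complex.mul_conj', ← mul_pow, ← Complex.ofReal_mul,
      div_mul_cancel₀ _ hz'.ne']
  have hmin : IsLocalMinOn (fun w => c ^ 2 * ‖w‖ ^ 2 - ‖f w‖ ^ 2) (ball 0 ‖z‖) z := by
    filter_upwards [self_mem_nhdsWithin] with w hw
    have hschwarz : ‖f w‖ ≤ c * ‖w‖ := by
      simpa [hf0] using Complex.dist_le_div_mul_dist_of_mapsTo_ball hf (by rwa [hf0]) hw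
    rw [← mul_pow, div_mul_cancel₀ _ hz'.ne', sub_self, ← mul_pow, sub_nonneg]
    gcongr
  have hu_norm : u = ‖u‖ := eq_norm_of_forall_re_mul_le fun ζ hζ => by
    have hdir : ζ * z - z ∈ posTangentConeAt (ball 0 ‖z‖) z :=
      sub_mem_posTangentConeAt_of_mem_interior (convex_ball 0 ‖z‖)
        (by simp [closure_ball _ hz'.ne'])
        (by simpa [isOpen_ball.interior_eq] using mul_lt_of_lt_one_left hz' hζ)
    have hu_sub : (c : ℂ) ^ 2 * ((ζ * z - z) * conj z) - (ζ * z - z) * d * conj (f z) =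
        u - ζ * u := by
      linear_combination (ζ - 1) * hcz
    have hnonneg := re_sub_nonneg_of_isLocalMinOn hd hmin hdir
    rwa [hu_sub, Complex.sub_re, sub_nonneg] at hnonneg
  refine ⟨1 + ‖u‖ / ‖f z‖ ^ 2, le_add_of_nonneg_right (by positivity), ?_⟩
  have hconj : conj (f z) ≠ 0 := (map_ne_zero _).2 hfz
  push_cast
  rw [← hu_norm, ← Complex.mul_conj', hu]
  field_simp
  ring

theorem norm_sub_one_sq (v : ℂ) : ‖v - 1‖ ^ 2 = ‖v + 1‖ ^ 2 - 4 * v.re := by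
  simp only [← Complex.normSq_eq_norm_sq, Complex.normSq_add, Complex.normSq_sub, map_one, mul_one]
  ring

theorem add_one_ne_zero_of_re_nonneg {v : ℂ} (hv : 0 ≤ v.re) : v + 1 ≠ 0 :=
  Complex.ne_zero_of_re_pos (by simpa using add_pos_of_nonneg_of_pos hv one_pos)

theorem norm_cayley_le_one {v : ℂ} (hv : 0 ≤ v.re) : ‖(v - 1) / (v + 1)‖ ≤ 1 := by
  rw [norm_div]
  refine div_le_one_of_le₀ (le_of_sq_le_sq ?_ (norm_nonneg _)) (norm_nonneg _)
  linarith [norm_sub_one_sq v]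

theorem norm_cayley_eq_one {v : ℂ} (hv : v.re = 0) : ‖(v - 1) / (v + 1)‖ = 1 := by
  rw [norm_div, div_eq_one_iff_eq (norm_ne_zero_iff.2 (add_one_ne_zero_of_re_nonneg hv.ge)),
    ← sq_eq_sq₀ (norm_nonneg _) (norm_nonneg _), norm_sub_one_sq, hv, mul_zero, sub_zero]

/-- Jack's lemma transported to the right half-plane by the Cayley transform. -/
theorem exists_mul_deriv_eq_of_re_nonneg {p : ℂ → ℂ} {d z : ℂ} (hz : z ≠ 0)
    (hp : DifferentiableOn ℂ p (ball 0 ‖z‖)) (hp0 : p 0 = 1)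
    (hre : ∀ w ∈ ball 0 ‖z‖, 0 ≤ (p w).re) (hpz : (p z).re = 0) (hd : HasDerivAt p d z) :
    ∃ t : ℝ, t ≤ -(1 + (p z).im ^ 2) / 2 ∧ z * d = t := by
  have hnorm := norm_cayley_eq_one hpz
  have hne := add_one_ne_zero_of_re_nonneg hpz.ge
  obtain ⟨m, hm, hzd⟩ := exists_mul_deriv_eq_mul_of_mapsTo_ball
    (f := fun w => (p w - 1) / (p w + 1)) hz
    ((hp.sub_const 1).div (hp.add_const 1) fun w hw => add_one_ne_zero_of_re_nonneg (hre w hw))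
    (by simp [hp0])
    (fun w hw => by simpa only [hnorm, mem_closedBall_zero_iff] using norm_cayley_le_one (hre w hw))
    (norm_ne_zero_iff.1 (hnorm.trans_ne one_ne_zero))
    ((hd.sub_const 1).div (hd.add_const 1) hne)
  refine ⟨-(m * (1 + (p z).im ^ 2) / 2), by nlinarith [sq_nonneg (p z).im], ?_⟩
  have hsq : p z ^ 2 = -((p z).im : ℂ) ^ 2 := by
    have hpz_eq : p z = (p z).im * Complex.I := Complex.ext (by simp [hpz]) (by simp)
    rw [hpz_eq, mul_pow, Complex.I_sq, ← hpz_eq, mul_neg_one]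
  field_simp at hzd
  push_cast
  linear_combination hzd / 2 + m * hsq / 2

theorem tendsto_sub_mul_logDeriv {𝕜 : Type*} [NontriviallyNormedField 𝕜] [CompleteSpace 𝕜]
    {f : 𝕜 → 𝕜} {z : 𝕜} (hf : AnalyticAt 𝕜 f z) (hne : analyticOrderAt f z ≠ ⊤) :
    Tendsto (fun w => (w - z) * logDeriv f w) (𝓝[≠] z) (𝓝 (analyticOrderNatAt f z)) := by
  obtain ⟨g, hg, hgz, hfg⟩ := hf.analyticOrderAt_ne_top.1 hne
  set n := analyticOrderNatAt f z
  have hlim : Tendsto (fun w => n + (w - z) * logDeriv g w) (𝓝[≠] z) (𝓝 n) := by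
    have hcont : ContinuousAt (fun w => n + (w - z) * (deriv g w / g w)) z := by
      have := hg.continuousAt
      have := hg.deriv.continuousAt
      fun_prop (disch := assumption)
    simpa [ContinuousAt, logDeriv_apply] using hcont.mono_left nhdsWithin_le_nhds
  refine hlim.congr' ?_
  filter_upwards [logDeriv_congr_nhdsNE (hfg.filter_mono nhdsWithin_le_nhds),
    hg.eventually_analyticAt.filter_mono nhdsWithin_le_nhds,
    (hg.continuousAt.eventually_ne hgz).filter_mono nhdsWithin_le_nhds,
    self_mem_nhdsWithin] with w hw hgw hgw0 hwz
  have hwz' : w - z ≠ 0 := sub_ne_zero.2 hwz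
  have hsub : DifferentiableAt 𝕜 (fun v => v - z) w := differentiableAt_id.sub_const z
  have hlog : logDeriv (fun v => v - z) w = 1 / (w - z) := by
    rw [logDeriv_apply, deriv_sub_const_fun, deriv_id'']
  simp only [smul_eq_mul] at hw
  rw [hw, logDeriv_mul (f := fun v => (v - z) ^ n) w (pow_ne_zero n hwz') hgw0 (hsub.fun_pow n)
    hgw.differentiableAt, logDeriv_fun_pow hsub, hlog]
  field_simp

/-- The logarithmic derivative with respect to the Euler operator `z d/dz`, that is,
`z f'(z) / f(z)`, with junk value `0` where `f` vanishes. Spirallikeness and the Riccati form of a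
second-order linear equation are conditions on it. -/
noncomputable def eulerLogDeriv {𝕜 : Type*} [NontriviallyNormedField 𝕜] (f : 𝕜 → 𝕜) (z : 𝕜) : 𝕜 :=
  z * logDeriv f z

section EulerLogDeriv

variable {𝕜 : Type*} [NontriviallyNormedField 𝕜] {f : 𝕜 → 𝕜} {z : 𝕜}

theorem eulerLogDeriv_zero (f : 𝕜 → 𝕜) : eulerLogDeriv f 0 = 0 := zero_mul _

theorem eulerLogDeriv_id_mul (hz : z ≠ 0) (hf : DifferentiableAt 𝕜 f z) (hfz : f z ≠ 0) :
    eulerLogDeriv (fun w => w * f w) z = 1 + eulerLogDeriv f z := by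
  rw [eulerLogDeriv, logDeriv_mul (f := fun w => w) z hz hfz differentiableAt_fun_id hf,
    logDeriv_id', mul_add, mul_one_div_cancel hz, eulerLogDeriv]

theorem differentiableAt_eulerLogDeriv (hf : DifferentiableAt 𝕜 f z)
    (hf' : DifferentiableAt 𝕜 (deriv f) z) (hfz : f z ≠ 0) :
    DifferentiableAt 𝕜 (eulerLogDeriv f) z :=
  differentiableAt_id.mul (hf'.div hf hfz)

theorem mul_deriv_eulerLogDeriv_add_sq (hf : DifferentiableAt 𝕜 f z)
    (hf' : DifferentiableAt 𝕜 (deriv f) z) (hfz : f z ≠ 0) :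
    z * deriv (eulerLogDeriv f) z + eulerLogDeriv f z ^ 2 =
      (z * deriv f z + z ^ 2 * deriv (deriv f) z) / f z := by
  have hd : deriv (eulerLogDeriv f) z = _ :=
    ((hasDerivAt_id z).mul (hf'.hasDerivAt.div hf.hasDerivAt hfz)).deriv
  rw [hd, eulerLogDeriv, logDeriv_apply, id_eq, Pi.div_apply]
  field_simp
  ring

end EulerLogDeriv

section Radial

variable {E : Type*} [NormedAddCommGroup E] [NormedSpace ℝ E] {y : E}

theorem tendsto_smul_nhdsLT_one (hy : y ≠ 0) :
    Tendsto (fun r : ℝ => r • y) (𝓝[<] 1) (𝓝[≠] y) := by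
  have hcont : Continuous fun r : ℝ => r • y := by fun_prop
  refine tendsto_nhdsWithin_iff.2
    ⟨(hcont.tendsto' 1 y (one_smul ℝ y)).mono_left nhdsWithin_le_nhds, ?_⟩
  filter_upwards [self_mem_nhdsWithin] with r hr hry
  exact hr.ne (smul_left_injective ℝ hy (hry.trans (one_smul ℝ y).symm))

theorem eventually_norm_smul_lt_nhdsLT_one (hy : y ≠ 0) : ∀ᶠ r : ℝ in 𝓝[<] 1, ‖r • y‖ < ‖y‖ := by
  filter_upwards [Ioo_mem_nhdsLT zero_lt_one] with r hr
  rw [norm_smul, Real.norm_of_nonneg hr.1.le]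
  exact mul_lt_of_lt_one_left (norm_pos_iff.2 hy) hr.2

end Radial

theorem tendsto_sub_one_mul_eulerLogDeriv_smul {F : ℂ → ℂ} {y : ℂ} (hy : y ≠ 0)
    (hF : AnalyticAt ℂ F y) (hne : analyticOrderAt F y ≠ ⊤) :
    Tendsto (fun r : ℝ => ((r - 1 : ℝ) : ℂ) * eulerLogDeriv F (r • y)) (𝓝[<] 1)
      (𝓝 (analyticOrderNatAt F y)) := by
  have hr : Tendsto (fun r : ℝ => (r : ℂ)) (𝓝[<] 1) (𝓝 1) :=
    (Complex.continuous_ofReal.tendsto' 1 1 Complex.ofReal_one).mono_left nhdsWithin_le_nhds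
  have hlim := hr.mul ((tendsto_sub_mul_logDeriv hF hne).comp (tendsto_smul_nhdsLT_one hy))
  rw [one_mul] at hlim
  refine hlim.congr fun r => ?_
  rw [Function.comp_apply, eulerLogDeriv, Complex.real_smul, Complex.ofReal_sub, Complex.ofReal_one]
  ring

/-- At a zero of order `n`, the quotient `z F'(z) / F(z)` behaves like `n / (r - 1)` along the ray
`z = r y`, `r → 1⁻`. -/
theorem ne_zero_of_re_one_add_eulerLogDeriv_div_nonneg {F : ℂ → ℂ} {κ y : ℂ} (hκ : 0 < κ.re)
    (hy : y ≠ 0) (hF : AnalyticAt ℂ F y) (hne : ∀ w ∈ ball 0 ‖y‖, F w ≠ 0)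
    (hre : ∀ w ∈ ball 0 ‖y‖, 0 ≤ (1 + eulerLogDeriv F w / κ).re) : F y ≠ 0 := by
  have hinside : ∀ᶠ r : ℝ in 𝓝[<] 1, r • y ∈ ball 0 ‖y‖ := by
    simpa only [mem_ball_zero_iff] using eventually_norm_smul_lt_nhdsLT_one hy
  have horder : analyticOrderAt F y ≠ ⊤ := fun htop => by
    have hzero : ∀ᶠ w in 𝓝[≠] y, F w = 0 :=
      (analyticOrderAt_eq_top.1 htop).filter_mono nhdsWithin_le_nhds
    obtain ⟨r, hFr, hr⟩ := (((tendsto_smul_nhdsLT_one hy).eventually hzero).and hinside).exists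
    exact hne _ hr hFr
  set n := analyticOrderNatAt F y
  have hlim : Tendsto (fun r : ℝ => (r - 1) * (1 + eulerLogDeriv F (r • y) / κ).re) (𝓝[<] 1)
      (𝓝 (n / κ : ℂ).re) := by
    have hr : Tendsto (fun r : ℝ => ((r - 1 : ℝ) : ℂ)) (𝓝[<] 1) (𝓝 0) :=
      (Continuous.tendsto' (by fun_prop) 1 0 (by simp)).mono_left nhdsWithin_le_nhds
    have hsum := hr.add ((tendsto_sub_one_mul_eulerLogDeriv_smul hy hF horder).div_const κ)
    rw [zero_add] at hsum
    refine ((Complex.continuous_re.tendsto _).comp hsum).congr fun r => ?_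
    rw [Function.comp_apply, ← Complex.re_ofReal_mul, mul_add, mul_one, mul_div_assoc]
  have hle : (n / κ : ℂ).re ≤ 0 := by
    refine le_of_tendsto hlim ?_
    filter_upwards [hinside, self_mem_nhdsWithin] with r hr hr1
    exact mul_nonpos_of_nonpos_of_nonneg (sub_nonpos.2 hr1.le) (hre _ hr)
  have hn0 : n = 0 := by
    rw [div_eq_mul_inv, ← Complex.ofReal_natCast, Complex.re_ofReal_mul, Complex.inv_re] at hle
    have hinv : 0 < κ.re / Complex.normSq κ :=
      div_pos hκ (Complex.normSq_pos.2 (Complex.ne_zero_of_re_pos hκ))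
    have hn_le : (n : ℝ) ≤ 0 := nonpos_of_mul_nonpos_left hle hinv
    exact_mod_cast le_antisymm hn_le n.cast_nonneg
  rw [← hF.analyticOrderAt_eq_zero]
  exact (ENat.toNat_eq_zero.1 hn0).resolve_right horder

theorem exists_eq_zero_and_forall_ball_pos {E : Type*} [NormedAddCommGroup E] [NormedSpace ℝ E]
    [ProperSpace E] {g : E → ℝ} {z : E} (hg : ContinuousOn g (closedBall 0 ‖z‖)) (hg0 : 0 < g 0)
    (hgz : g z ≤ 0) :
    ∃ y ∈ closedBall 0 ‖z‖, y ≠ 0 ∧ g y = 0 ∧ ∀ w ∈ ball 0 ‖y‖, 0 < g w := by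
  have hcompact : IsCompact (closedBall 0 ‖z‖ ∩ g ⁻¹' Set.Iic 0) :=
    (isCompact_closedBall 0 ‖z‖).of_isClosed_subset
      (hg.preimage_isClosed_of_isClosed isClosed_closedBall isClosed_Iic) Set.inter_subset_left
  obtain ⟨y, ⟨hy, hgy⟩, hmin⟩ :=
    hcompact.exists_isMinOn ⟨z, by simp, hgz⟩ continuous_norm.continuousOn
  have hsub : closedBall (0 : E) ‖y‖ ⊆ closedBall 0 ‖z‖ :=
    closedBall_subset_closedBall (by simpa using hy)
  have hy0 : y ≠ 0 := by
    rintro rfl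
    exact hgy.not_gt hg0
  have hpos : ∀ w ∈ ball 0 ‖y‖, 0 < g w := fun w hw => by
    by_contra! hgw
    have hle : ‖y‖ ≤ ‖w‖ := hmin ⟨hsub (ball_subset_closedBall hw), hgw⟩
    exact hle.not_gt (mem_ball_zero_iff.1 hw)
  have hyball : y ∈ closure (ball (0 : E) ‖y‖) := by simp [closure_ball _ (norm_ne_zero_iff.2 hy0)]
  have hcont : ContinuousWithinAt g (ball 0 ‖y‖) y :=
    (hg y hy).mono (ball_subset_closedBall.trans hsub)
  have hgy' : 0 ≤ g y := ContinuousWithinAt.closure_le hyball continuousWithinAt_const hcont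
    fun w hw => (hpos w hw).le
  exact ⟨y, hy, hy0, hgy.antisymm hgy', hpos⟩

theorem exists_eq_mul_of_re_one_add_div_nonneg {q : ℂ → ℂ} {κ d z : ℂ} (hκ : κ ≠ 0) (hz : z ≠ 0)
    (hq : DifferentiableOn ℂ q (ball 0 ‖z‖)) (hq0 : q 0 = 0)
    (hre : ∀ w ∈ ball 0 ‖z‖, 0 ≤ (1 + q w / κ).re) (hqz : (1 + q z / κ).re = 0)
    (hd : HasDerivAt q d z) :
    ∃ s t : ℝ, t ≤ -(1 + s ^ 2) / 2 ∧ q z = κ * (Complex.I * s - 1) ∧ z * d = κ * t := by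
  obtain ⟨t, ht, hzd⟩ := exists_mul_deriv_eq_of_re_nonneg hz ((hq.div_const κ).const_add 1)
    (by simp [hq0]) hre hqz ((hd.div_const κ).const_add 1)
  refine ⟨_, t, ht, ?_, ?_⟩
  · have hI : 1 + q z / κ = (1 + q z / κ).im * Complex.I := Complex.ext (by simp [hqz]) (by simp)
    rw [mul_comm Complex.I, ← hI]
    field_simp
    ring
  · rw [← hzd]
    field_simp

/-- The factor `normSq (F w)` removes the poles of `eulerLogDeriv F` at the zeros of `F`. -/
theorem continuousOn_normSq_mul_re_one_add_eulerLogDeriv_div {F : ℂ → ℂ} {s : Set ℂ}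
    (hF : AnalyticOnNhd ℂ F s) (κ : ℂ) :
    ContinuousOn (fun w => Complex.normSq (F w) * (1 + eulerLogDeriv F w / κ).re) s := by
  have hconj := Complex.continuous_conj.comp_continuousOn hF.continuousOn
  have hcont : ContinuousOn (fun w => ((F w + w * deriv F w / κ) * conj (F w)).re) s :=
    Complex.continuous_re.comp_continuousOn
      ((hF.continuousOn.add ((continuousOn_id.mul hF.deriv.continuousOn).div_const κ)).mul hconj)
  refine hcont.congr fun w _ => ?_
  rw [← Complex.re_ofReal_mul, ← Complex.mul_conj, eulerLogDeriv, logDeriv_apply]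
  rcases eq_or_ne (F w) 0 with hFw | hFw
  · simp [hFw]
  · congr 1
    field_simp

/-- The principle of Miller and Mocanu. The function `g` is continuous across the zeros of `F`,
so there is a first point where the conclusion fails. -/
theorem ne_zero_and_re_one_add_eulerLogDeriv_div_pos {F : ℂ → ℂ} {κ : ℂ} {R : ℝ} (hκ : 0 < κ.re)
    (hF : AnalyticOnNhd ℂ F (ball 0 R)) (hF0 : F 0 ≠ 0)
    (hadm : ∀ z ∈ ball 0 R, F z ≠ 0 → ∀ s t : ℝ, t ≤ -(1 + s ^ 2) / 2 →
      eulerLogDeriv F z = κ * (Complex.I * s - 1) → z * deriv (eulerLogDeriv F) z ≠ κ * t)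
    {z : ℂ} (hz : z ∈ ball 0 R) : F z ≠ 0 ∧ 0 < (1 + eulerLogDeriv F z / κ).re := by
  let g : ℂ → ℝ := fun w => Complex.normSq (F w) * (1 + eulerLogDeriv F w / κ).re
  have g_pos_iff : ∀ {w}, 0 < g w ↔ F w ≠ 0 ∧ 0 < (1 + eulerLogDeriv F w / κ).re := fun {w} => by
    rcases eq_or_ne (F w) 0 with hFw | hFw
    · simp [g, hFw]
    · simp [g, hFw, Complex.normSq_pos]
  rw [← g_pos_iff]
  by_contra! hgz
  have hg0 : 0 < g 0 := g_pos_iff.2 ⟨hF0, by simp [eulerLogDeriv_zero]⟩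
  have hsub : closedBall (0 : ℂ) ‖z‖ ⊆ ball 0 R := closedBall_subset_ball (mem_ball_zero_iff.1 hz)
  have hgcont : ContinuousOn g (closedBall 0 ‖z‖) :=
    continuousOn_normSq_mul_re_one_add_eulerLogDeriv_div (hF.mono hsub) κ
  obtain ⟨y, hyz, hy0, hgy, hpos⟩ := exists_eq_zero_and_forall_ball_pos hgcont hg0 hgz
  have hyR : y ∈ ball 0 R := hsub hyz
  have hballR : ball (0 : ℂ) ‖y‖ ⊆ ball 0 R := ball_subset_ball (mem_ball_zero_iff.1 hyR).le
  have hF_ne : ∀ w ∈ ball 0 ‖y‖, F w ≠ 0 := fun w hw => (g_pos_iff.1 (hpos w hw)).1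
  have hre : ∀ w ∈ ball 0 ‖y‖, 0 ≤ (1 + eulerLogDeriv F w / κ).re := fun w hw =>
    (g_pos_iff.1 (hpos w hw)).2.le
  have hFy : F y ≠ 0 := ne_zero_of_re_one_add_eulerLogDeriv_div_nonneg hκ hy0 (hF y hyR) hF_ne hre
  have hrey : (1 + eulerLogDeriv F y / κ).re = 0 :=
    (mul_eq_zero.1 hgy).resolve_left (mt Complex.normSq_eq_zero.1 hFy)
  have hq : ∀ w ∈ ball 0 R, F w ≠ 0 → DifferentiableAt ℂ (eulerLogDeriv F) w := fun w hw =>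
    differentiableAt_eulerLogDeriv (hF w hw).differentiableAt (hF.deriv w hw).differentiableAt
  obtain ⟨s, t, ht, hqy, hq'y⟩ := exists_eq_mul_of_re_one_add_div_nonneg
    (Complex.ne_zero_of_re_pos hκ) hy0
    (fun w hw => (hq w (hballR hw) (hF_ne w hw)).differentiableWithinAt) (eulerLogDeriv_zero F)
    hre hrey (hq y hyR hFy).hasDerivAt
  exact hadm y hyR hFy s t ht hqy hq'y

section PowerSeries

open FormalMultilinearSeries

variable {𝕜 : Type*} [NontriviallyNormedField 𝕜] {f : 𝕜 → 𝕜} {u : ℕ → 𝕜} {r : ENNReal} {z : 𝕜}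

theorem hasSum_ofScalars (hf : HasFPowerSeriesOnBall f (ofScalars 𝕜 u) 0 r)
    (hz : z ∈ eball 0 r) : HasSum (fun n => u n * z ^ n) (f z) := by
  simpa only [ofScalars_apply_eq, smul_eq_mul, zero_add] using hf.hasSum hz

variable [CompleteSpace 𝕜]

theorem hasFPowerSeriesOnBall_deriv_ofScalars {x : 𝕜}
    (hf : HasFPowerSeriesOnBall f (ofScalars 𝕜 u) x r) :
    HasFPowerSeriesOnBall (deriv f) (ofScalars 𝕜 fun n => (n + 1) * u (n + 1)) x r := by
  have hseries : (ContinuousLinearMap.apply 𝕜 𝕜 (1 : 𝕜)).compFormalMultilinearSeries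
      (ofScalars 𝕜 u).derivSeries = ofScalars 𝕜 fun n => (n + 1) * u (n + 1) := by
    funext n
    have hcoeff : (ofScalars 𝕜 u).derivSeries.coeff n 1 = (n + 1) * u (n + 1) := by
      rw [derivSeries_coeff_one, coeff_ofScalars, nsmul_eq_mul, Nat.cast_succ]
    rw [← mkPiRing_coeff_eq (ofScalars 𝕜 fun n => (n + 1) * u (n + 1)) n, coeff_ofScalars,
      ← hcoeff]
    exact (mkPiRing_coeff_eq _ n).symm
  rw [← hseries]
  exact (ContinuousLinearMap.apply 𝕜 𝕜 (1 : 𝕜)).comp_hasFPowerSeriesOnBall hf.fderiv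

theorem hasSum_mul_deriv_ofScalars (hf : HasFPowerSeriesOnBall f (ofScalars 𝕜 u) 0 r)
    (hz : z ∈ eball 0 r) : HasSum (fun n => n * u n * z ^ n) (z * deriv f z) := by
  rw [← hasSum_nat_add_iff' 1]
  simpa [pow_succ', mul_left_comm, mul_assoc] using
    (hasSum_ofScalars (hasFPowerSeriesOnBall_deriv_ofScalars hf) hz).mul_left z

theorem hasSum_sq_mul_deriv_deriv_ofScalars (hf : HasFPowerSeriesOnBall f (ofScalars 𝕜 u) 0 r)
    (hz : z ∈ eball 0 r) :
    HasSum (fun n => n * (n - 1) * u n * z ^ n) (z ^ 2 * deriv (deriv f) z) := by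
  rw [← hasSum_nat_add_iff' 1]
  simpa [pow_succ', mul_left_comm, mul_assoc] using
    (hasSum_mul_deriv_ofScalars (hasFPowerSeriesOnBall_deriv_ofScalars hf) hz).mul_left z

end PowerSeries

section Hypergeometric

theorem one_le_radius_ordinaryHypergeometricSeries {𝕂 : Type*} (𝔸 : Type*) [RCLike 𝕂]
    [NormedDivisionRing 𝔸] [NormedAlgebra 𝕂 𝔸] (a b c : 𝕂) :
    1 ≤ (ordinaryHypergeometricSeries 𝔸 a b c).radius := by
  by_cases h : ∀ k : ℕ, (k : 𝕂) ≠ -a ∧ (k : 𝕂) ≠ -b ∧ (k : 𝕂) ≠ -c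
  · exact (ordinaryHypergeometricSeries_radius_eq_one 𝔸 a b c h).ge
  · push Not at h
    obtain ⟨k, hk⟩ := h
    suffices hradius : (ordinaryHypergeometricSeries 𝔸 a b c).radius = ⊤ from hradius ▸ le_top
    by_cases ha : (k : 𝕂) = -a
    · rw [← neg_eq_iff_eq_neg.2 ha]
      exact ordinaryHypergeometric_radius_top_of_neg_nat₁ 𝔸 b c
    by_cases hb : (k : 𝕂) = -b
    · rw [← neg_eq_iff_eq_neg.2 hb]
      exact ordinaryHypergeometric_radius_top_of_neg_nat₂ 𝔸 a c
    · rw [← neg_eq_iff_eq_neg.2 (hk ha hb)]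
      exact ordinaryHypergeometric_radius_top_of_neg_nat₃ 𝔸 a b

theorem hasFPowerSeriesOnBall_ordinaryHypergeometric {𝕂 : Type*} {𝔸 : Type*} [RCLike 𝕂]
    [NormedDivisionRing 𝔸] [NormedAlgebra 𝕂 𝔸] [CompleteSpace 𝔸] (a b c : 𝕂) :
    HasFPowerSeriesOnBall (ordinaryHypergeometric a b c : 𝔸 → 𝔸)
      (ordinaryHypergeometricSeries 𝔸 a b c) 0 1 :=
  have hradius := one_le_radius_ordinaryHypergeometricSeries 𝔸 a b c
  (FormalMultilinearSeries.hasFPowerSeriesOnBall _ (one_pos.trans_le hradius)).mono one_pos hradius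

theorem ordinaryHypergeometricCoefficient_succ {𝕂 : Type*} [Field 𝕂] [CharZero 𝕂] (a b : 𝕂) {c : 𝕂}
    {n : ℕ} (hc : c + n ≠ 0) :
    (n + 1) * (c + n) * ordinaryHypergeometricCoefficient a b c (n + 1) =
      (a + n) * (b + n) * ordinaryHypergeometricCoefficient a b c n := by
  have hn : (n + 1 : 𝕂) ≠ 0 := by exact_mod_cast n.succ_ne_zero
  simp only [ordinaryHypergeometricCoefficient, ascPochhammer_succ_eval, Nat.factorial_succ,
    mul_inv, Nat.cast_mul, Nat.cast_add, Nat.cast_one]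
  field_simp

variable {𝕂 : Type*} [RCLike 𝕂] {a b c z : 𝕂}

theorem ordinaryHypergeometric_ode (hc : ∀ n : ℕ, c ≠ -n) (hz : ‖z‖ < 1) :
    z * (1 - z) * deriv (deriv (ordinaryHypergeometric a b c)) z +
        (c - (a + b + 1) * z) * deriv (ordinaryHypergeometric a b c) z =
      a * b * ordinaryHypergeometric a b c z := by
  have hF := hasFPowerSeriesOnBall_ordinaryHypergeometric (𝔸 := 𝕂) a b c
  have hF' := hasFPowerSeriesOnBall_deriv_ofScalars hF
  have hz' : z ∈ eball 0 1 := by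
    rwa [← ENNReal.ofReal_one, eball_ofReal, mem_ball_zero_iff]
  have hleft := (hasSum_mul_deriv_ofScalars hF' hz').add ((hasSum_ofScalars hF' hz').mul_left c)
  have hright := ((hasSum_sq_mul_deriv_deriv_ofScalars hF hz').add
    ((hasSum_mul_deriv_ofScalars hF hz').mul_left (a + b + 1))).add
      ((hasSum_ofScalars hF hz').mul_left (a * b))
  have heq := hleft.unique (hright.congr_fun fun n => ?_)
  · linear_combination heq
  · have hcn : c + n ≠ 0 := fun h => hc n (eq_neg_of_add_eq_zero_left h)
    linear_combination z ^ n * ordinaryHypergeometricCoefficient_succ a b hcn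

theorem eulerLogDeriv_ordinaryHypergeometric_riccati (hc : ∀ n : ℕ, c ≠ -n) (hz : ‖z‖ < 1)
    (hFz : ordinaryHypergeometric a b c z ≠ 0) :
    (1 - z) * (z * deriv (eulerLogDeriv (ordinaryHypergeometric a b c)) z +
        eulerLogDeriv (ordinaryHypergeometric a b c) z ^ 2) +
      (c - 1 - (a + b) * z) * eulerLogDeriv (ordinaryHypergeometric a b c) z = a * b * z := by
  have hF : AnalyticAt 𝕂 (ordinaryHypergeometric a b c) z :=
    (hasFPowerSeriesOnBall_ordinaryHypergeometric a b c).analyticAt_of_mem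
      (by rwa [← ENNReal.ofReal_one, eball_ofReal, mem_ball_zero_iff])
  rw [mul_deriv_eulerLogDeriv_add_sq hF.differentiableAt hF.deriv.differentiableAt hFz,
    eulerLogDeriv, logDeriv_apply]
  field_simp
  linear_combination z * ordinaryHypergeometric_ode (a := a) (b := b) hc hz

end Hypergeometric

theorem quadratic_nonneg {𝕜 : Type*} [Field 𝕜] [LinearOrder 𝕜] [IsStrictOrderedRing 𝕜]
    {L M N : 𝕜} (hL : 0 ≤ L) (hN : 0 ≤ N) (h : 0 ≤ L * N - M ^ 2) (s : 𝕜) :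
    0 ≤ L * s ^ 2 - 2 * M * s + N := by
  rcases hL.eq_or_lt with rfl | hL
  · obtain rfl : M = 0 := by
      rw [zero_mul, zero_sub, neg_nonneg] at h
      exact pow_eq_zero_iff two_ne_zero |>.1 (h.antisymm (sq_nonneg M))
    linarith
  · have hsq : L * (L * s ^ 2 - 2 * M * s + N) = (L * s - M) ^ 2 + (L * N - M ^ 2) := by ring
    exact nonneg_of_mul_nonneg_right (hsq ▸ add_nonneg (sq_nonneg _) h) hL

theorem neg_half_lt_re_div_one_sub {z : ℂ} (hz : ‖z‖ < 1) : -(1 / 2) < (z / (1 - z)).re := by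
  have hz1 : 1 - z ≠ 0 := sub_ne_zero.2 fun h => by simp [← h] at hz
  have hnorm : Complex.normSq z < 1 := by
    rw [Complex.normSq_eq_norm_sq]
    exact pow_lt_one₀ (norm_nonneg z) hz two_ne_zero
  rw [Complex.div_re, ← add_div, lt_div_iff₀ (Complex.normSq_pos.2 hz1)]
  simp only [Complex.normSq_apply, Complex.sub_re, Complex.sub_im, Complex.one_re,
    Complex.one_im] at hnorm ⊢
  linarith

/-- The scale `κ = (1 - α) cos l · e^{i l}` of spirallikeness of order `α`: `z F(z)` satisfies the
spirallike inequality at `z` exactly when `1 + z F'(z) / (κ F(z))` has positive real part. -/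
noncomputable def spiralScale (l α : ℝ) : ℂ :=
  ((1 - α) * Real.cos l : ℝ) * Complex.exp (Complex.I * l)

theorem re_exp_neg_I_mul (l : ℝ) : (Complex.exp (-(Complex.I * l))).re = Real.cos l := by
  simp [Complex.exp_re]

theorem spiralScale_re (l α : ℝ) : (spiralScale l α).re = (1 - α) * Real.cos l ^ 2 := by
  rw [spiralScale, Complex.re_ofReal_mul, mul_comm Complex.I, Complex.exp_ofReal_mul_I_re]
  ring

theorem exp_neg_I_mul_mul_spiralScale (l α : ℝ) :
    Complex.exp (-(Complex.I * l)) * spiralScale l α = ((1 - α) * Real.cos l : ℝ) := by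
  rw [spiralScale, mul_left_comm, ← Complex.exp_add, neg_add_cancel, Complex.exp_zero, mul_one]

theorem conj_spiralScale (l α : ℝ) :
    conj (spiralScale l α) = ((1 - α) * Real.cos l : ℝ) * Complex.exp (-(Complex.I * l)) := by
  rw [spiralScale, map_mul, Complex.conj_ofReal, ← Complex.exp_conj, map_mul, Complex.conj_I,
    Complex.conj_ofReal, neg_mul]

theorem conj_spiralScale_eq_one_add_exp (l α : ℝ) :
    conj (spiralScale l α) =
      (1 - α) * (1 + Complex.exp (-(2 * Complex.I * l))) / 2 := by
  have hsq : Complex.exp (-(2 * Complex.I * l)) = Complex.exp (-(Complex.I * l)) ^ 2 := by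
    rw [← Complex.exp_nat_mul]
    congr 1
    push_cast
    ring
  have hcos : 2 * Complex.cos l =
      Complex.exp (Complex.I * l) + Complex.exp (-(Complex.I * l)) := by
    rw [Complex.two_cos, neg_mul, mul_comm Complex.I]
  have hinv : Complex.exp (Complex.I * l) * Complex.exp (-(Complex.I * l)) = 1 := by
    rw [← Complex.exp_add, add_neg_cancel, Complex.exp_zero]
  rw [conj_spiralScale, hsq, Complex.ofReal_mul, Complex.ofReal_cos]
  push_cast
  linear_combination ((1 - α) / 2 * Complex.exp (-(Complex.I * l))) * hcos + (1 - α) / 2 * hinv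

theorem re_spiral_quadratic (l α s t : ℝ) (a b : ℂ) :
    (Complex.exp (-(Complex.I * l)) * a * b * (t + conj (spiralScale l α) * (Complex.I * s + 1) ^ 2
      - (conj a + conj b) * (Complex.I * s + 1))).re =
    (Complex.exp (-(Complex.I * l)) * a * b).re * (t + (1 + s ^ 2) / 2)
      - (spiralL l α a b * s ^ 2 - 2 * spiralM l α a b * s + spiralN l α a b
        + Complex.normSq (a * b) / ((1 - α) * Real.cos l)) / 2 := by
  rw [conj_spiralScale_eq_one_add_exp, spiralL, spiralM, spiralN, Complex.normSq_mul,
    Complex.normSq_eq_norm_sq, Complex.normSq_eq_norm_sq]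
  generalize Complex.exp (-(Complex.I * l)) * a * b = X
  generalize Complex.exp (-(2 * Complex.I * l)) = E
  generalize ‖a‖ ^ 2 * ‖b‖ ^ 2 / ((1 - α) * Real.cos l) = D
  simp only [pow_two, Complex.mul_re, Complex.mul_im, Complex.add_re, Complex.add_im,
    Complex.sub_re, Complex.sub_im, Complex.div_ofNat_re, Complex.div_ofNat_im, Complex.ofReal_re,
    Complex.ofReal_im, Complex.one_re, Complex.one_im, Complex.I_re, Complex.I_im, Complex.conj_re,
    Complex.conj_im, Complex.re_ofNat, Complex.im_ofNat]
  ring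

theorem re_conj_riccati {a b κ v : ℂ} {s t : ℝ}
    (h : κ * t + (κ * (Complex.I * s - 1)) ^ 2 + (a + b) * (κ * (Complex.I * s - 1)) =
      a * b * v) :
    (a * b * conj κ * (t + conj κ * (Complex.I * s + 1) ^ 2
      - (conj a + conj b) * (Complex.I * s + 1))).re =
      Complex.normSq (a * b) * v.re := by
  have hconj := congrArg conj h
  rw [map_mul conj (a * b)] at hconj
  simp only [map_add, map_sub, map_mul conj κ, map_mul conj (a + b), map_mul conj Complex.I,
    map_pow, map_one, Complex.conj_I, Complex.conj_ofReal] at hconj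
  rw [← Complex.conj_re v, ← Complex.re_ofReal_mul, ← Complex.mul_conj]
  congr 1
  linear_combination (a * b) * hconj

theorem riccati_ne_of_spiral_nonneg {l α : ℝ} (hk : 0 < (1 - α) * Real.cos l) {a b z : ℂ}
    (hpos : 0 < (Complex.exp (-(Complex.I * l)) * a * b).re)
    (hL : 0 ≤ spiralL l α a b) (hN : 0 ≤ spiralN l α a b)
    (hLMN : 0 ≤ spiralL l α a b * spiralN l α a b - spiralM l α a b ^ 2) (hz : ‖z‖ < 1)
    {s t : ℝ} (ht : t ≤ -(1 + s ^ 2) / 2) :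
    spiralScale l α * t + (spiralScale l α * (Complex.I * s - 1)) ^ 2 +
      (a + b) * (spiralScale l α * (Complex.I * s - 1)) ≠ a * b * (z / (1 - z)) := by
  intro hric
  have hab : a * b ≠ 0 := fun h => by simp [mul_assoc, h] at hpos
  have hquad := quadratic_nonneg hL hN hLMN s
  have hle : (Complex.exp (-(Complex.I * l)) * a * b).re * (t + (1 + s ^ 2) / 2) ≤ 0 :=
    mul_nonpos_of_nonneg_of_nonpos hpos.le (by linarith)
  have hre := re_conj_riccati hric
  rw [show a * b * conj (spiralScale l α) = ((1 - α) * Real.cos l : ℝ) *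
      (Complex.exp (-(Complex.I * l)) * a * b) by rw [conj_spiralScale]; ring, mul_assoc,
    Complex.re_ofReal_mul, re_spiral_quadratic] at hre
  have hupper : Complex.normSq (a * b) * (z / (1 - z)).re ≤ Complex.normSq (a * b) * -(1 / 2) :=
    calc
      _ ≤ (1 - α) * Real.cos l * -(Complex.normSq (a * b) / ((1 - α) * Real.cos l) / 2) :=
        hre ▸ mul_le_mul_of_nonneg_left (by linarith) hk.le
      _ = Complex.normSq (a * b) * -(1 / 2) := by
        rw [mul_neg, ← mul_div_assoc, mul_div_cancel₀ _ hk.ne']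
        ring
  exact hupper.not_gt
    (mul_lt_mul_of_pos_left (neg_half_lt_re_div_one_sub hz) (Complex.normSq_pos.2 hab))

theorem isNormalizedAnalytic_id_mul {F : ℂ → ℂ} (hF : AnalyticOnNhd ℂ F (ball 0 1))
    (hF0 : F 0 = 1) : IsNormalizedAnalytic fun z => z * F z := by
  refine ⟨fun z hz => analyticAt_id.mul (hF z hz), zero_mul _, ?_⟩
  have hderiv := (hasDerivAt_id (0 : ℂ)).mul
    (hF 0 (mem_ball_self one_pos)).differentiableAt.hasDerivAt
  exact hderiv.deriv.trans (by simp [hF0])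

theorem isSpirallikeOfOrder_id_mul {l α : ℝ} (hk : 0 < (1 - α) * Real.cos l) {F : ℂ → ℂ}
    (hF : AnalyticOnNhd ℂ F (ball 0 1)) (hF0 : F 0 = 1)
    (hre : ∀ z ∈ ball 0 1, F z ≠ 0 ∧ 0 < (1 + eulerLogDeriv F z / spiralScale l α).re) :
    IsSpirallikeOfOrder l α fun z => z * F z := by
  refine ⟨isNormalizedAnalytic_id_mul hF hF0, fun z hz hz0 => ?_⟩
  obtain ⟨hFz, hpos⟩ := hre z (mem_ball_zero_iff.2 hz)
  refine ⟨mul_ne_zero hz0 hFz, ?_⟩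
  have hquot : z * deriv (fun w => w * F w) z / (z * F z) = 1 + eulerLogDeriv F z := by
    rw [← eulerLogDeriv_id_mul hz0 (hF z (mem_ball_zero_iff.2 hz)).differentiableAt hFz,
      eulerLogDeriv, logDeriv_apply, mul_div_assoc]
  have hκ : spiralScale l α ≠ 0 :=
    right_ne_zero_of_mul ((exp_neg_I_mul_mul_spiralScale l α).trans_ne
      (Complex.ofReal_ne_zero.2 hk.ne'))
  have hscale : Complex.exp (-(Complex.I * l)) * (1 + eulerLogDeriv F z) =
      Complex.exp (-(Complex.I * l)) - ((1 - α) * Real.cos l : ℝ) +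
        ((1 - α) * Real.cos l : ℝ) * (1 + eulerLogDeriv F z / spiralScale l α) := by
    rw [← exp_neg_I_mul_mul_spiralScale]
    field_simp
    ring
  rw [hquot, hscale, Complex.add_re, Complex.sub_re, Complex.re_ofReal_mul, Complex.ofReal_re,
    re_exp_neg_I_mul]
  linarith [mul_pos hk hpos]

theorem mainTheorem4_general {l α : ℝ} (hcos : 0 < Real.cos l) (hα : α < 1) {a b : ℂ}
    (hab : ∀ n : ℕ, a + b ≠ -((n : ℂ) + 1))
    (hpos : 0 < (Complex.exp (-(Complex.I * (l : ℂ))) * a * b).re)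
    (hL : 0 ≤ spiralL l α a b) (hN : 0 ≤ spiralN l α a b)
    (hLMN : 0 ≤ spiralL l α a b * spiralN l α a b - spiralM l α a b ^ 2) :
    IsSpirallikeOfOrder l α (shiftedHypergeometric a b (a + b + 1)) := by
  have hF : AnalyticOnNhd ℂ (ordinaryHypergeometric a b (a + b + 1)) (ball (0 : ℂ) 1) := by
    rw [← eball_ofReal, ENNReal.ofReal_one]
    exact (hasFPowerSeriesOnBall_ordinaryHypergeometric a b (a + b + 1)).analyticOnNhd
  have hF0 : ordinaryHypergeometric a b (a + b + 1) (0 : ℂ) = 1 := ordinaryHypergeometric_zero a b _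
  have hk : 0 < (1 - α) * Real.cos l := mul_pos (sub_pos.2 hα) hcos
  have hκ : 0 < (spiralScale l α).re := by
    rw [spiralScale_re]
    exact mul_pos (sub_pos.2 hα) (pow_pos hcos 2)
  have hc : ∀ n : ℕ, a + b + 1 ≠ -n := fun n h => hab n (by linear_combination h)
  refine isSpirallikeOfOrder_id_mul hk hF hF0 fun z hz =>
    ne_zero_and_re_one_add_eulerLogDeriv_div_pos hκ hF (hF0.trans_ne one_ne_zero) ?_ hz
  intro w hw hFw s t ht hval hderiv
  rw [mem_ball_zero_iff] at hw
  have hw1 : 1 - w ≠ 0 := sub_ne_zero.2 fun h => by simp [← h] at hw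
  have hric := eulerLogDeriv_ordinaryHypergeometric_riccati hc hw hFw
  rw [hval, hderiv] at hric
  refine riccati_ne_of_spiral_nonneg hk hpos hL hN hLMN hw ht ?_
  field_simp
  linear_combination hric

theorem mainTheorem4 (l α : ℝ) (hl : |l| < Real.pi / 2) (hα0 : 0 ≤ α) (hα1 : α < 1)
    (a b : ℂ) (hab : ∀ n : ℕ, a + b ≠ -((n : ℂ) + 1))
    (hpos : 0 < (Complex.exp (-(Complex.I * (l : ℂ))) * a * b).re)
    (hL : 0 ≤ spiralL l α a b) (hN : 0 ≤ spiralN l α a b)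
    (hLMN : 0 ≤ spiralL l α a b * spiralN l α a b - spiralM l α a b ^ 2) :
    IsSpirallikeOfOrder l α (shiftedHypergeometric a b (a + b + 1)) :=
  mainTheorem4_general (Real.cos_pos_of_mem_Ioo (abs_lt.1 hl)) hα1 hab hpos hL hN hLMN
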